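/- **Theorem 1.** Let $I\subseteq\mathbb R$ be an interval and let $\bm\eta_p=(x_p,y_p,z_p):I\to\mathbb R^3$ be a $C^1$ curve with $\bm\eta_p'(u)\neq 0$ for all $u\in I$ (for example a regular $C^1$ Pythagorean-hodograph spline). Identify vectors of $\mathbb R^3$ with pure quaternions and put $\mathcal Q_z(\chi)=\cos\frac\chi2+\sin\frac\chi2\,\mathbf k$, $\mathcal Q_y(\nu)=\cos\frac\nu2+\sin\frac\nu2\,\mathbf j$. Let $\mathrm{atan}_2(y,x)\in(-\pi,\pi]$ be the four-quadrant angle of the point $(x,y)$, with $\mathrm{atan}_2(0,0)=0$. The path angles are $$\chi_p=\mathrm{atan}_2(y_p',x_p'),\qquad \nu_p=\mathrm{atan}_2\bigl(-z_p',\sqrt{x_p'^2+y_p'^2}\bigr),$$ the path frame is $\mathcal Q_p=\mathcal Q_z(\chi_p)\mathcal Q_y(\nu_p)$, and the track error of a position $\bm\eta\in\mathbb R^3$ with respect to the path point $\bm\eta_p(u)$ is $$\bm\varepsilon^p=(s,e,h)=\mathcal Q_p^*(\bm\eta-\bm\eta_p(u))\mathcal Q_p .$$ Let $\Delta_e,\mu,\gamma>0$,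 and let the desired speed $U_d=U_d(s,e,h)>0$ be a positive continuous function of the track error (for example a constant, or $U_d=\frac{U_0}{\mu\Delta_e}\sqrt{\mu^2(\Delta_e^2+e^2)+h^2}$ with $U_0>0$). Put $\Delta_h=\mu\sqrt{\Delta_e^2+e^2}$, $\chi_r=\arctan(-e/\Delta_e)$, $\nu_r=\arctan(h/\Delta_h)$. The guidance law is $$\dot{\bm\eta}_d=\mathcal Q_d\,(U_d,0,0)^\top\mathcal Q_d^*,\qquad \mathcal Q_d=\mathcal Q_z(\chi_d)\mathcal Q_y(\nu_d),\qquad \dot u=\frac{U_d\cos\chi_r\cos\nu_r+\gamma s}{\Vert\bm\eta_p'(u)\Vert},$$ where $\nu_d=\arcsin(\sin\nu_p\cos\chi_r\cos\nu_r+\cos\nu_p\sin\nu_r)$ and $\chi_d=\mathrm{atan}_2(x_{num},x_{den})$ with $$x_{num}=\cos\chi_p\sin\chi_r\cos\nu_r-\sin\chi_p\sin\nu_p\sin\nu_r+\sin\chi_p\cos\chi_r\cos\nu_p\cos\nu_r,$$ $$x_{den}=-\sin\chi_p\sin\chi_r\cos\nu_r-\cos\chi_p\sin\nu_p\sin\nu_r+\cos\chi_p\cos\chi_r\cos\nu_p\cos\nu_r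 .$$ Let $\dot{\bm\eta}_c\in\mathbb R^3$ be a constant current velocity and $k_c>0$. Suppose that the vehicle position $\bm\eta(t)\in\mathbb R^3$, the path parameter $u(t)\in I$ and the estimate $\dot{\hat{\bm\eta}}_c(t)\in\mathbb R^3$ of the current velocity are differentiable for all $t\ge0$ and satisfy, for all $t\ge 0$, the equation for $\dot u$ above together with $$\dot{\bm\eta}=\dot{\bm\eta}_d-\dot{\hat{\bm\eta}}_c+\dot{\bm\eta}_c,\qquad \ddot{\hat{\bm\eta}}_c=k_c\,(\bm\eta-\bm\eta_p(u)).$$ Then the estimation error $\dot{\tilde{\bm\eta}}_c=\dot{\bm\eta}_c-\dot{\hat{\bm\eta}}_c$ and the track error satisfy $$\lim_{t\to\infty}\Vert\dot{\tilde{\bm\eta}}_c(t)\Vert=0,\qquad \lim_{t\to\infty}\Vert\bm\varepsilon^p(t)\Vert=0 .$$ -/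

import Mathlib

open Filter Topology
open scoped Quaternion

noncomputable section

namespace PathFollowing

/-- Euclidean three-space; coordinates `0, 1, 2` are `x, y, z`. -/
abbrev E3 := EuclideanSpace ℝ (Fin 3)

/-- A vector of three-space as a pure quaternion. -/
def toQuat (v : E3) : ℍ[ℝ] := ⟨0, v 0, v 1, v 2⟩

/-- The vector part of a quaternion. -/
def vecPart (q : ℍ[ℝ]) : E3 := !₂[q.imI, q.imJ, q.imK]

/-- The quaternion product `Q v Q*`, read as a vector. -/
def rotate (Q : ℍ[ℝ]) (v : E3) : E3 := vecPart (Q * toQuat v * star Q)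

/-- Rotation by the angle `χ` about the `z` axis. -/
def quatZ (χ : ℝ) : ℍ[ℝ] := ⟨Real.cos (χ / 2), 0, 0, Real.sin (χ / 2)⟩

/-- Rotation by the angle `ν` about the `y` axis. -/
def quatY (ν : ℝ) : ℍ[ℝ] := ⟨Real.cos (ν / 2), 0, Real.sin (ν / 2), 0⟩

/-- Four-quadrant inverse tangent: the angle in `(-π, π]` of the planar point `(x, y)`
(and `0` at the origin). -/
def atan2 (y x : ℝ) : ℝ := Complex.arg ⟨x, y⟩

/-- Azimuth angle of the path, from the tangent vector `d = η_p'`. -/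
def azimuth (d : E3) : ℝ := atan2 (d 1) (d 0)

/-- Elevation angle of the path, from the tangent vector `d = η_p'`. -/
def elevation (d : E3) : ℝ := atan2 (-(d 2)) (Real.sqrt (d 0 ^ 2 + d 1 ^ 2))

/-- The unit quaternion `Q_p` that maps path-frame vectors to navigation-frame vectors. -/
def pathQuat (d : E3) : ℍ[ℝ] := quatZ (azimuth d) * quatY (elevation d)

/-- The track error `(s, e, h) = Q_p* (η - η_p) Q_p`; `d` is the path tangent and `p` the path
point. -/
def trackError (d p η : E3) : E3 := rotate (star (pathQuat d)) (η - p)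

/-- The guidance parameters `Δ_e`, `μ`, `γ`. -/
structure Params where
  Δe : ℝ
  μ : ℝ
  γ : ℝ

/-- The control azimuth `χ_r`, a function of the cross-track error `e`. -/
def chiR (P : Params) (ε : E3) : ℝ := Real.arctan (-(ε 1 / P.Δe))

/-- `Δ_h = μ √(Δ_e² + e²)`. -/
def deltaH (P : Params) (ε : E3) : ℝ := P.μ * Real.sqrt (P.Δe ^ 2 + ε 1 ^ 2)

/-- The control elevation `ν_r`, a function of `e` and of the vertical-track error `h`. -/
def nuR (P : Params) (ε : E3) : ℝ := Real.arctan (ε 2 / deltaH P ε)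

/-- The desired azimuth `χ_d`, from the path angles `χp, νp` and the control angles `χr, νr`. -/
def chiD (χp νp χr νr : ℝ) : ℝ :=
  atan2
    (Real.cos χp * Real.sin χr * Real.cos νr - Real.sin χp * Real.sin νp * Real.sin νr
      + Real.sin χp * Real.cos χr * Real.cos νp * Real.cos νr)
    (-(Real.sin χp * Real.sin χr * Real.cos νr) - Real.cos χp * Real.sin νp * Real.sin νr
      + Real.cos χp * Real.cos χr * Real.cos νp * Real.cos νr)

/-- The desired elevation `ν_d`. -/
def nuD (νp χr νr : ℝ) : ℝ :=
  Real.arcsin (Real.sin νp * Real.cos χr * Real.cos νr + Real.cos νp * Real.sin νr)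

/-- The desired velocity `Q_d (U_d, 0, 0) Q_d*`, where `Q_d = Q_z(χ_d) Q_y(ν_d)`, for the path
tangent `d`, the track error `ε` and the desired speed `Ud`. -/
def desiredVelocity (P : Params) (d ε : E3) (Ud : ℝ) : E3 :=
  rotate
    (quatZ (chiD (azimuth d) (elevation d) (chiR P ε) (nuR P ε))
      * quatY (nuD (elevation d) (chiR P ε) (nuR P ε)))
    !₂[Ud, 0, 0]

/-- The guidance law for the rate of the path parameter,
`(U_d cos χ_r cos ν_r + γ s) / ‖η_p'‖`. -/
def parameterRate (P : Params) (d ε : E3) (Ud : ℝ) : ℝ :=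
  (Ud * Real.cos (chiR P ε) * Real.cos (nuR P ε) + P.γ * ε 0) / ‖d‖

/-- The speed law `U_d = U₀ / (μ Δ_e) · √(μ² (Δ_e² + e²) + h²)` with steady speed `U₀`. -/
def steadySpeedLaw (P : Params) (U₀ : ℝ) (ε : E3) : ℝ :=
  U₀ / (P.μ * P.Δe) * Real.sqrt (P.μ ^ 2 * (P.Δe ^ 2 + ε 1 ^ 2) + ε 2 ^ 2)

/-- An admissible speed law: the desired speed `U_d` is a positive continuous function of the
track error. -/
def IsSpeedLaw (U : E3 → ℝ) : Prop := Continuous U ∧ ∀ ε, 0 < U ε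

lemma isSpeedLaw_const {U₀ : ℝ} (h : 0 < U₀) : IsSpeedLaw (fun _ => U₀) :=
  ⟨continuous_const, fun _ => h⟩

lemma isSpeedLaw_steadySpeedLaw {P : Params} {U₀ : ℝ} (hU : 0 < U₀) (hΔ : 0 < P.Δe)
    (hμ : 0 < P.μ) : IsSpeedLaw (steadySpeedLaw P U₀) := by
  refine ⟨?_, fun ε => ?_⟩
  · unfold steadySpeedLaw
    fun_prop
  · unfold steadySpeedLaw
    positivity

/-- The path `ηp` is a regular `C¹` curve on the parameter interval `I`. -/
structure IsRegularPath (I : Set ℝ) (ηp : ℝ → E3) : Prop where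
  interval : I.OrdConnected
  contDiffOn : ContDiffOn ℝ 1 ηp I
  regular : ∀ v ∈ I, derivWithin ηp I v ≠ 0

/-- The track error at time `t` for the vehicle motion `η` and the path parameter `u`. -/
def trackErrorAt (I : Set ℝ) (ηp η : ℝ → E3) (u : ℝ → ℝ) (t : ℝ) : E3 :=
  trackError (derivWithin ηp I (u t)) (ηp (u t)) (η t)

/-- `η` (vehicle position), `cHat` (estimated current velocity) and `u` (path parameter) form a
motion on `[0, ∞)` of the closed loop made of the guidance law, the kinematics
`η' = η_d' - cHat + c` with current velocity `c`, and the estimator `cHat' = k_c (η - η_p(u))`.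
Derivatives at `t = 0` are one-sided. -/
structure IsTrajectory (P : Params) (U : E3 → ℝ) (I : Set ℝ) (ηp : ℝ → E3) (c : E3) (kc : ℝ)
    (η cHat : ℝ → E3) (u : ℝ → ℝ) : Prop where
  parameter_mem : ∀ t, 0 ≤ t → u t ∈ I
  kinematics : ∀ t, 0 ≤ t →
    HasDerivWithinAt η
      (desiredVelocity P (derivWithin ηp I (u t)) (trackErrorAt I ηp η u t)
        (U (trackErrorAt I ηp η u t)) - cHat t + c)
      (Set.Ici 0) t
  estimator : ∀ t, 0 ≤ t →
    HasDerivWithinAt cHat (kc • (η t - ηp (u t))) (Set.Ici 0) t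
  parameter : ∀ t, 0 ≤ t →
    HasDerivWithinAt u
      (parameterRate P (derivWithin ηp I (u t)) (trackErrorAt I ηp η u t)
        (U (trackErrorAt I ηp η u t)))
      (Set.Ici 0) t

end PathFollowing

end

open Filter Topology
open scoped Quaternion

noncomputable section

namespace PathFollowing

/-! ### Rotations of three-space by quaternions -/

section Rotation

/-! The proof stays in the inertial frame, with q = η - η_p(u) and w = c - cHat. Rotations preserve
norms, so ‖q‖ is the norm of the track error, and the path frame, which need not vary differentiably
along a C¹ path, is never differentiated. The desired velocity has the components prescribed by the
control angles in the path frame (`desiredVelocity_eq`). Subtracting the velocity of the path point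
leaves a diagonal feedback with positive gains, so q' = A + w with A the rotated feedback, and w' =
-k q. For V = k‖q‖² + ‖w‖² the cross terms cancel and V' = 2k⟨q, A⟩ ≤ 0. Hence q and w are bounded,
and compactness makes the gains uniformly positive (`exists_feedback_bounds`). A Barbalat argument
gives q → 0. Then A and w' also tend to 0, so over a unit time q changes by nearly w, which forces w
→ 0. -/

@[simp] lemma re_toQuat (v : E3) : (toQuat v).re = 0 := rfl
@[simp] lemma imI_toQuat (v : E3) : (toQuat v).imI = v 0 := rfl
@[simp] lemma imJ_toQuat (v : E3) : (toQuat v).imJ = v 1 := rfl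
@[simp] lemma imK_toQuat (v : E3) : (toQuat v).imK = v 2 := rfl

@[simp] lemma re_quatZ (χ : ℝ) : (quatZ χ).re = Real.cos (χ / 2) := rfl
@[simp] lemma imI_quatZ (χ : ℝ) : (quatZ χ).imI = 0 := rfl
@[simp] lemma imJ_quatZ (χ : ℝ) : (quatZ χ).imJ = 0 := rfl
@[simp] lemma imK_quatZ (χ : ℝ) : (quatZ χ).imK = Real.sin (χ / 2) := rfl

@[simp] lemma re_quatY (ν : ℝ) : (quatY ν).re = Real.cos (ν / 2) := rfl
@[simp] lemma imI_quatY (ν : ℝ) : (quatY ν).imI = 0 := rfl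
@[simp] lemma imJ_quatY (ν : ℝ) : (quatY ν).imJ = Real.sin (ν / 2) := rfl
@[simp] lemma imK_quatY (ν : ℝ) : (quatY ν).imK = 0 := rfl

lemma inner_eq_coord (v w : E3) :
    inner ℝ v w = v 0 * w 0 + v 1 * w 1 + v 2 * w 2 := by
  simp [PiLp.inner_apply, Fin.sum_univ_three, mul_comm]

lemma norm_sq_eq_coord (v : E3) : ‖v‖ ^ 2 = v 0 ^ 2 + v 1 ^ 2 + v 2 ^ 2 := by
  rw [← real_inner_self_eq_norm_sq, inner_eq_coord]; ring

lemma toQuat_rotate (Q : ℍ[ℝ]) (v : E3) : toQuat (rotate Q v) = Q * toQuat v * star Q := by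
  ext <;> simp [rotate, vecPart]
  ring

lemma vecPart_toQuat (v : E3) : vecPart (toQuat v) = v := by
  ext i; fin_cases i <;> simp [vecPart]

lemma rotate_mul (Q Q' : ℍ[ℝ]) (v : E3) : rotate (Q * Q') v = rotate Q (rotate Q' v) := by
  conv_rhs => rw [rotate, toQuat_rotate]
  simp only [rotate, star_mul, mul_assoc]

lemma rotate_one (v : E3) : rotate 1 v = v := by
  simp [rotate, vecPart_toQuat]

lemma rotate_add (Q : ℍ[ℝ]) (v w : E3) : rotate Q (v + w) = rotate Q v + rotate Q w := by
  ext i; fin_cases i <;> simp [rotate, vecPart] <;> ring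

lemma rotate_smul (Q : ℍ[ℝ]) (a : ℝ) (v : E3) : rotate Q (a • v) = a • rotate Q v := by
  ext i; fin_cases i <;> simp [rotate, vecPart] <;> ring

/-- A polynomial identity in the coordinates; each rotated vector contributes one factor `normSq Q`.
-/
lemma inner_rotate (Q : ℍ[ℝ]) (v w : E3) :
    inner ℝ (rotate Q v) (rotate Q w) = Quaternion.normSq Q ^ 2 * inner ℝ v w := by
  simp only [inner_eq_coord, Quaternion.normSq_def']
  simp [rotate, vecPart]
  ring

lemma norm_rotate {Q : ℍ[ℝ]} (hQ : Quaternion.normSq Q = 1) (v : E3) : ‖rotate Q v‖ = ‖v‖ := by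
  rw [← sq_eq_sq₀ (norm_nonneg _) (norm_nonneg _), ← real_inner_self_eq_norm_sq,
    ← real_inner_self_eq_norm_sq, inner_rotate, hQ]
  ring

lemma rotate_rotate_star {Q : ℍ[ℝ]} (hQ : Quaternion.normSq Q = 1) (v : E3) :
    rotate Q (rotate (star Q) v) = v := by
  rw [← rotate_mul, Quaternion.self_mul_star, hQ]
  simpa using rotate_one v

/-- The rotation by `Q_z(χ) Q_y(ν)` in coordinates. -/
lemma rotate_quatZ_mul_quatY (χ ν : ℝ) (v : E3) :
    rotate (quatZ χ * quatY ν) v =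
      !₂[Real.cos χ * (Real.cos ν * v 0 + Real.sin ν * v 2) - Real.sin χ * v 1,
        Real.sin χ * (Real.cos ν * v 0 + Real.sin ν * v 2) + Real.cos χ * v 1,
        Real.cos ν * v 2 - Real.sin ν * v 0] := by
  -- Doubled angles turn the half angles of the quaternions into plain variables, ready for the
  -- double-angle formulas.
  obtain ⟨a, rfl⟩ : ∃ a, χ = 2 * a := ⟨χ / 2, by ring⟩
  obtain ⟨b, rfl⟩ : ∃ b, ν = 2 * b := ⟨ν / 2, by ring⟩
  have hy (w : E3) : rotate (quatY (2 * b)) w =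
      !₂[Real.cos (2 * b) * w 0 + Real.sin (2 * b) * w 2, w 1,
        Real.cos (2 * b) * w 2 - Real.sin (2 * b) * w 0] := by
    have h := Real.sin_sq_add_cos_sq b
    ext i
    fin_cases i <;>
      simp [rotate, vecPart, Real.cos_two_mul', Real.sin_two_mul]
    · ring
    · linear_combination w 1 * h
    · ring
  have hz (w : E3) : rotate (quatZ (2 * a)) w =
      !₂[Real.cos (2 * a) * w 0 - Real.sin (2 * a) * w 1,
        Real.sin (2 * a) * w 0 + Real.cos (2 * a) * w 1, w 2] := by
    have h := Real.sin_sq_add_cos_sq a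
    ext i
    fin_cases i <;>
      simp [rotate, vecPart, Real.cos_two_mul', Real.sin_two_mul]
    · ring
    · ring
    · linear_combination w 2 * h
  rw [rotate_mul, hy, hz]
  simp

end Rotation

/-! ### The path frame and the desired velocity -/

section PathFrame

lemma normSq_pathQuat (d : E3) : Quaternion.normSq (pathQuat d) = 1 := by
  rw [pathQuat, map_mul]
  simp [Quaternion.normSq_def']

lemma rotate_pathQuat_trackError (d p η : E3) :
    rotate (pathQuat d) (trackError d p η) = η - p :=
  rotate_rotate_star (normSq_pathQuat d) _

lemma norm_trackError (d p η : E3) : ‖trackError d p η‖ = ‖η - p‖ := by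
  rw [← norm_rotate (normSq_pathQuat d), rotate_pathQuat_trackError]

/-- The radius factor makes this true at the origin as well, so vertical directions need no separate
case. -/
lemma sqrt_mul_cos_atan2 (y x : ℝ) : Real.sqrt (x ^ 2 + y ^ 2) * Real.cos (atan2 y x) = x := by
  simpa [atan2, Complex.norm_eq_sqrt_sq_add_sq] using Complex.norm_mul_cos_arg ⟨x, y⟩

lemma sqrt_mul_sin_atan2 (y x : ℝ) : Real.sqrt (x ^ 2 + y ^ 2) * Real.sin (atan2 y x) = y := by
  simpa [atan2, Complex.norm_eq_sqrt_sq_add_sq] using Complex.norm_mul_sin_arg ⟨x, y⟩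

/-- The first axis of the path frame is the unit tangent of the path. -/
lemma norm_smul_rotate_pathQuat (d : E3) : ‖d‖ • rotate (pathQuat d) !₂[1, 0, 0] = d := by
  have hn : ‖d‖ = Real.sqrt (Real.sqrt (d 0 ^ 2 + d 1 ^ 2) ^ 2 + (-(d 2)) ^ 2) := by
    rw [Real.sq_sqrt (by positivity), neg_sq, ← norm_sq_eq_coord, Real.sqrt_sq (norm_nonneg _)]
  have hc := sqrt_mul_cos_atan2 (-(d 2)) (Real.sqrt (d 0 ^ 2 + d 1 ^ 2))
  have hs := sqrt_mul_sin_atan2 (-(d 2)) (Real.sqrt (d 0 ^ 2 + d 1 ^ 2))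
  have hc' := sqrt_mul_cos_atan2 (d 1) (d 0)
  have hs' := sqrt_mul_sin_atan2 (d 1) (d 0)
  rw [← hn] at hc hs
  rw [pathQuat, rotate_quatZ_mul_quatY, azimuth, elevation]
  ext i
  fin_cases i <;> simp
  · linear_combination Real.cos (atan2 (d 1) (d 0)) * hc + hc'
  · linear_combination Real.sin (atan2 (d 1) (d 0)) * hc + hs'
  · linear_combination -hs

/-- The desired velocity points, in the path frame, along the control angles. -/
lemma desiredVelocity_eq (P : Params) (d ε : E3) (Ud : ℝ) :
    desiredVelocity P d ε Ud = rotate (pathQuat d)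
      !₂[Ud * Real.cos (chiR P ε) * Real.cos (nuR P ε),
        Ud * Real.sin (chiR P ε) * Real.cos (nuR P ε), -(Ud * Real.sin (nuR P ε))] := by
  rw [desiredVelocity, pathQuat, rotate_quatZ_mul_quatY, rotate_quatZ_mul_quatY]
  generalize azimuth d = χp
  generalize elevation d = νp
  generalize chiR P ε = χr
  generalize nuR P ε = νr
  have h1 := Real.sin_sq_add_cos_sq χp
  have h2 := Real.sin_sq_add_cos_sq νp
  have h3 := Real.sin_sq_add_cos_sq χr
  have h4 := Real.sin_sq_add_cos_sq νr
  set N := Real.cos χp * Real.sin χr * Real.cos νr - Real.sin χp * Real.sin νp * Real.sin νr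
      + Real.sin χp * Real.cos χr * Real.cos νp * Real.cos νr with hN
  set D := -(Real.sin χp * Real.sin χr * Real.cos νr) - Real.cos χp * Real.sin νp * Real.sin νr
      + Real.cos χp * Real.cos χr * Real.cos νp * Real.cos νr with hD
  set S := Real.sin νp * Real.cos χr * Real.cos νr + Real.cos νp * Real.sin νr with hS
  -- (D, N, -S) is the image under the path rotation of the unit vector with control angles χr, νr,
  -- hence has norm 1.
  have hsum : D ^ 2 + N ^ 2 = 1 - S ^ 2 := by
    have e1 : D ^ 2 + N ^ 2 = (Real.sin χr * Real.cos νr) ^ 2 +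
        (Real.cos νp * Real.cos χr * Real.cos νr - Real.sin νp * Real.sin νr) ^ 2 := by
      rw [hN, hD]
      linear_combination ((Real.sin χr * Real.cos νr) ^ 2 +
        (Real.cos νp * Real.cos χr * Real.cos νr - Real.sin νp * Real.sin νr) ^ 2) * h1
    rw [e1, hS]
    linear_combination ((Real.cos χr * Real.cos νr) ^ 2 + Real.sin νr ^ 2) * h2 +
      Real.cos νr ^ 2 * h3 + h4
  have hsin : Real.sin (nuD νp χr νr) = S := by
    rw [nuD, ← hS]
    exact Real.sin_arcsin (by nlinarith [sq_nonneg D, sq_nonneg N])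
      (by nlinarith [sq_nonneg D, sq_nonneg N])
  -- The cosine of the desired elevation is the radius of (D, N), exactly the factor needed to
  -- recover D and N from their `atan2`.
  have hcos : Real.cos (nuD νp χr νr) = Real.sqrt (D ^ 2 + N ^ 2) := by
    rw [nuD, ← hS, Real.cos_arcsin, hsum]
  have hc := sqrt_mul_cos_atan2 N D
  have hs := sqrt_mul_sin_atan2 N D
  rw [← hcos] at hc hs
  have hχ : chiD χp νp χr νr = atan2 N D := rfl
  rw [hχ]
  ext i
  fin_cases i <;> simp
  · linear_combination Ud * hc + Ud * hD
  · linear_combination Ud * hs + Ud * hN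
  · linear_combination -Ud * hsin - Ud * hS

end PathFrame

/-! ### Feedback gains and their bounds -/

section Gains

/-- The cross-track feedback gain: `U_d sin χ_r cos ν_r = -(gain) e`. -/
def crossGain (P : Params) (U : E3 → ℝ) (ε : E3) : ℝ :=
  U ε * Real.cos (nuR P ε) / (P.Δe * Real.sqrt (1 + (ε 1 / P.Δe) ^ 2))

/-- The vertical-track feedback gain: `U_d sin ν_r = (gain) h`. -/
def verticalGain (P : Params) (U : E3 → ℝ) (ε : E3) : ℝ :=
  U ε / (deltaH P ε * Real.sqrt (1 + (ε 2 / deltaH P ε) ^ 2))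

/-- The feedback part of the error dynamics, in the path frame. -/
def feedback (P : Params) (U : E3 → ℝ) (ε : E3) : E3 :=
  !₂[-(P.γ * ε 0), -(crossGain P U ε * ε 1), -(verticalGain P U ε * ε 2)]

variable {P : Params} {U : E3 → ℝ}

lemma deltaH_pos (hΔ : 0 < P.Δe) (hμ : 0 < P.μ) (ε : E3) : 0 < deltaH P ε := by
  unfold deltaH; positivity

lemma continuous_deltaH : Continuous (deltaH P) := by
  unfold deltaH; fun_prop

lemma continuous_nuR (hΔ : 0 < P.Δe) (hμ : 0 < P.μ) : Continuous (nuR P) := by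
  unfold nuR
  refine Real.continuous_arctan.comp (Continuous.div (by fun_prop) continuous_deltaH fun ε => ?_)
  exact (deltaH_pos hΔ hμ ε).ne'

lemma continuous_crossGain (hΔ : 0 < P.Δe) (hμ : 0 < P.μ) (hU : IsSpeedLaw U) :
    Continuous (crossGain P U) := by
  unfold crossGain
  refine Continuous.div (hU.1.mul (Real.continuous_cos.comp (continuous_nuR hΔ hμ)))
    (by fun_prop) fun ε => ?_
  positivity

lemma crossGain_pos (hΔ : 0 < P.Δe) (hU : IsSpeedLaw U) (ε : E3) : 0 < crossGain P U ε := by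
  have := hU.2 ε
  have := Real.cos_arctan_pos (ε 2 / deltaH P ε)
  unfold crossGain nuR
  positivity

lemma continuous_verticalGain (hΔ : 0 < P.Δe) (hμ : 0 < P.μ) (hU : IsSpeedLaw U) :
    Continuous (verticalGain P U) := by
  have h : Continuous fun ε : E3 => ε 2 / deltaH P ε :=
    Continuous.div (by fun_prop) continuous_deltaH fun ε => (deltaH_pos hΔ hμ ε).ne'
  unfold verticalGain
  refine Continuous.div hU.1 (continuous_deltaH.mul
    (Real.continuous_sqrt.comp (continuous_const.add (h.pow 2)))) fun ε => ?_
  have := deltaH_pos hΔ hμ ε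
  positivity

lemma verticalGain_pos (hΔ : 0 < P.Δe) (hμ : 0 < P.μ) (hU : IsSpeedLaw U) (ε : E3) :
    0 < verticalGain P U ε := by
  have := hU.2 ε
  have := deltaH_pos hΔ hμ ε
  unfold verticalGain
  positivity

/-- From sin (arctan x) = x / √(1 + x²). No sign condition is needed, since inverses are
multiplicative even at zero. -/
lemma speed_mul_sin_chiR (ε : E3) :
    U ε * Real.sin (chiR P ε) * Real.cos (nuR P ε) = -(crossGain P U ε * ε 1) := by
  rw [chiR, Real.sin_arctan, crossGain, neg_sq]
  simp only [div_eq_mul_inv, mul_inv]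
  ring

lemma speed_mul_sin_nuR (ε : E3) :
    U ε * Real.sin (nuR P ε) = verticalGain P U ε * ε 2 := by
  rw [nuR, Real.sin_arctan, verticalGain]
  simp only [div_eq_mul_inv, mul_inv]
  ring

/-- In the path frame, the velocity of the vehicle relative to the path point is the feedback. -/
lemma desiredVelocity_sub_parameterRate_smul {d : E3} (hd : d ≠ 0) (ε : E3) :
    desiredVelocity P d ε (U ε) - parameterRate P d ε (U ε) • d =
      rotate (pathQuat d) (feedback P U ε) := by
  have hd' : ‖d‖ ≠ 0 := norm_ne_zero_iff.2 hd
  -- The path point moves along the first frame axis at speed U_d cos χ_r cos ν_r + γ s, so along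
  -- the track only -γ s survives.
  have h : parameterRate P d ε (U ε) • d =
      rotate (pathQuat d) ((parameterRate P d ε (U ε) * ‖d‖) • !₂[1, 0, 0]) := by
    rw [rotate_smul, mul_smul, norm_smul_rotate_pathQuat]
  rw [h, sub_eq_iff_eq_add, ← rotate_add, desiredVelocity_eq, parameterRate, div_mul_cancel₀ _ hd',
    speed_mul_sin_chiR, speed_mul_sin_nuR, feedback]
  congr 1
  ext i
  fin_cases i <;> simp

/-- Extreme values on a compact ball. The restriction to a ball matters: for constant U_d the gains
decay as the errors grow. -/
lemma exists_bounds_of_continuous_of_pos {f : E3 → ℝ} (hf : Continuous f) (hpos : ∀ x, 0 < f x)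
    (M : ℝ) : ∃ m C, 0 < m ∧ ∀ x, ‖x‖ ≤ M → m ≤ f x ∧ f x ≤ C := by
  have hK : IsCompact (Metric.closedBall (0 : E3) M) := isCompact_closedBall _ _
  obtain ⟨C, hC⟩ := hK.bddAbove_image hf.continuousOn
  obtain ⟨m, hm, hm'⟩ := hK.exists_forall_le' hf.continuousOn (a := 0) fun x _ => hpos x
  refine ⟨m, C, hm, fun x hx => ?_⟩
  have hx' : x ∈ Metric.closedBall (0 : E3) M := by simpa using hx
  exact ⟨hm' x hx', hC ⟨x, hx', rfl⟩⟩

/-- On bounded sets of track errors the feedback is strongly dissipative and linearly bounded. -/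
lemma exists_feedback_bounds (hΔ : 0 < P.Δe) (hμ : 0 < P.μ) (hγ : 0 < P.γ) (hU : IsSpeedLaw U)
    (M : ℝ) : ∃ m C, 0 < m ∧ 0 < C ∧ ∀ ε : E3, ‖ε‖ ≤ M →
      inner ℝ ε (feedback P U ε) ≤ -m * ‖ε‖ ^ 2 ∧ ‖feedback P U ε‖ ≤ C * ‖ε‖ := by
  obtain ⟨m₁, C₁, hm₁, h₁⟩ := exists_bounds_of_continuous_of_pos
    (continuous_crossGain hΔ hμ hU) (crossGain_pos hΔ hU) M
  obtain ⟨m₂, C₂, hm₂, h₂⟩ := exists_bounds_of_continuous_of_pos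
    (continuous_verticalGain hΔ hμ hU) (verticalGain_pos hΔ hμ hU) M
  refine ⟨min P.γ (min m₁ m₂), max P.γ (max C₁ C₂), lt_min hγ (lt_min hm₁ hm₂),
    lt_max_of_lt_left hγ, fun ε hε => ?_⟩
  obtain ⟨ha, ha'⟩ := h₁ ε hε
  obtain ⟨hb, hb'⟩ := h₂ ε hε
  have hg₀ : min P.γ (min m₁ m₂) ≤ P.γ := min_le_left _ _
  have hg₁ : min P.γ (min m₁ m₂) ≤ crossGain P U ε :=
    (min_le_right _ _).trans ((min_le_left _ _).trans ha)
  have hg₂ : min P.γ (min m₁ m₂) ≤ verticalGain P U ε :=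
    (min_le_right _ _).trans ((min_le_right _ _).trans hb)
  have hG₀ : P.γ ≤ max P.γ (max C₁ C₂) := le_max_left _ _
  have hG₁ : crossGain P U ε ≤ max P.γ (max C₁ C₂) :=
    ha'.trans ((le_max_left _ _).trans (le_max_right _ _))
  have hG₂ : verticalGain P U ε ≤ max P.γ (max C₁ C₂) :=
    hb'.trans ((le_max_right _ _).trans (le_max_right _ _))
  have hC : 0 < max P.γ (max C₁ C₂) := lt_max_of_lt_left hγ
  have hp₁ := crossGain_pos hΔ hU ε
  have hp₂ := verticalGain_pos hΔ hμ hU ε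
  generalize min P.γ (min m₁ m₂) = m at *
  generalize max P.γ (max C₁ C₂) = C at *
  constructor
  · rw [inner_eq_coord, norm_sq_eq_coord]
    simp only [feedback, PiLp.toLp_apply, Matrix.cons_val]
    nlinarith [mul_le_mul_of_nonneg_right hg₀ (sq_nonneg (ε 0)),
      mul_le_mul_of_nonneg_right hg₁ (sq_nonneg (ε 1)),
      mul_le_mul_of_nonneg_right hg₂ (sq_nonneg (ε 2))]
  · refine le_of_sq_le_sq ?_ (by positivity)
    rw [mul_pow, norm_sq_eq_coord, norm_sq_eq_coord]
    simp only [feedback, PiLp.toLp_apply, Matrix.cons_val, neg_sq, mul_pow, mul_add]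
    gcongr

end Gains

/-! ### Lyapunov and Barbalat arguments -/

section Convergence

variable {E : Type*} [NormedAddCommGroup E] [InnerProductSpace ℝ E]

lemma norm_sub_le_of_hasDerivWithinAt_Ici {f f' : ℝ → E} {C t s : ℝ}
    (hf : ∀ x, 0 ≤ x → HasDerivWithinAt f (f' x) (Set.Ici 0) x) (ht : 0 ≤ t) (hts : t ≤ s)
    (hC : ∀ x ∈ Set.Icc t s, ‖f' x‖ ≤ C) : ‖f s - f t‖ ≤ C * (s - t) := by
  refine norm_image_sub_le_of_norm_deriv_le_segment' (f' := f')
    (fun x hx => (hf x (ht.trans hx.1)).mono fun y hy => ht.trans hy.1)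
    (fun x hx => hC x ⟨hx.1, hx.2.le⟩) s ⟨hts, le_rfl⟩

lemma sub_le_of_hasDerivWithinAt_Ici {f f' : ℝ → ℝ} {C t s : ℝ}
    (hf : ∀ x, 0 ≤ x → HasDerivWithinAt f (f' x) (Set.Ici 0) x) (ht : 0 ≤ t) (hts : t ≤ s)
    (hC : ∀ x ∈ Set.Icc t s, f' x ≤ C) : f s - f t ≤ C * (s - t) := by
  have hmem : ∀ x ∈ Set.Icc t s, 0 ≤ x := fun x hx => ht.trans hx.1
  have h := image_le_of_deriv_right_le_deriv_boundary (f := f) (f' := f') (a := t) (b := s)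
    (B := fun x => f t + C * (x - t)) (B' := fun _ => C)
    (fun x hx => ((hf x (hmem x hx)).mono fun y hy => hmem y hy).continuousWithinAt)
    (fun x hx => (hf x (ht.trans hx.1)).mono fun y hy => (ht.trans hx.1).trans hy)
    (by simp) (by fun_prop)
    (fun x _ => by
      have := ((hasDerivAt_id x).sub_const t).const_mul C |>.const_add (f t)
      simpa using this.hasDerivWithinAt)
    (fun x hx => hC x ⟨hx.1, hx.2.le⟩) (x := s) ⟨hts, le_rfl⟩
  linarith

/-- A Barbalat-type lemma: if a function bounded below decreases at rate at least `m ‖q‖²` along a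
curve `q` of bounded speed, then `q` tends to zero. -/
lemma tendsto_zero_of_dissipation {q q' : ℝ → E} {V V' : ℝ → ℝ} {m L : ℝ} (hm : 0 < m)
    (hL : 0 < L) (hq : ∀ t, 0 ≤ t → HasDerivWithinAt q (q' t) (Set.Ici 0) t)
    (hq' : ∀ t, 0 ≤ t → ‖q' t‖ ≤ L)
    (hV : ∀ t, 0 ≤ t → HasDerivWithinAt V (V' t) (Set.Ici 0) t)
    (hV' : ∀ t, 0 ≤ t → V' t ≤ -m * ‖q t‖ ^ 2) (hV₀ : ∀ t, 0 ≤ t → 0 ≤ V t) :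
    Tendsto q atTop (𝓝 0) := by
  have hanti : ∀ t s, 0 ≤ t → t ≤ s → V s ≤ V t := fun t s ht hts => by
    have := sub_le_of_hasDerivWithinAt_Ici (C := 0) hV ht hts fun x hx =>
      (hV' x (ht.trans hx.1)).trans (by nlinarith [sq_nonneg ‖q x‖])
    linarith
  rw [Metric.tendsto_atTop]
  intro δ hδ
  -- In time τ a curve of speed at most L moves at most δ/2, so it stays outside radius δ/2 if it
  -- starts outside δ; V then drops by at least κ.
  set τ := δ / (2 * L) with hτ
  have hτ₀ : 0 < τ := by positivity
  set κ := m * (δ / 2) ^ 2 * τ with hκ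
  have hκ₀ : 0 < κ := by positivity
  have hbdd : BddBelow (V '' Set.Ici 0) := ⟨0, by rintro _ ⟨t, ht, rfl⟩; exact hV₀ t ht⟩
  -- From T on, V is within κ of its infimum, so no drop by κ is possible.
  obtain ⟨_, ⟨T, hT, rfl⟩, hTκ⟩ := Real.lt_sInf_add_pos
    (s := V '' Set.Ici 0) ⟨_, 0, le_refl (0 : ℝ), rfl⟩ hκ₀
  have hT : 0 ≤ T := hT
  refine ⟨T, fun t hTt => ?_⟩
  have ht : 0 ≤ t := hT.trans hTt
  rw [dist_zero_right]
  by_contra! hcon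
  have hlow : ∀ x ∈ Set.Icc t (t + τ), V' x ≤ -m * (δ / 2) ^ 2 := fun x hx => by
    have h1 := norm_sub_le_of_hasDerivWithinAt_Ici hq ht hx.1 fun y hy => hq' y (ht.trans hy.1)
    have h2 : L * (x - t) ≤ δ / 2 := by
      calc L * (x - t) ≤ L * τ := by gcongr; linarith [hx.2]
        _ = δ / 2 := by rw [hτ]; field_simp
    have h3 : δ / 2 ≤ ‖q x‖ := by
      have := norm_sub_norm_le (q t) (q x)
      rw [norm_sub_rev] at this
      linarith
    refine (hV' x (ht.trans hx.1)).trans ?_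
    have : (δ / 2) ^ 2 ≤ ‖q x‖ ^ 2 := by gcongr
    nlinarith
  have h4 := sub_le_of_hasDerivWithinAt_Ici hV ht (by linarith : t ≤ t + τ) hlow
  have h5 : sInf (V '' Set.Ici 0) ≤ V (t + τ) :=
    csInf_le hbdd ⟨t + τ, show (0 : ℝ) ≤ t + τ by linarith, rfl⟩
  have h6 := hanti T t hT hTt
  have h7 : -m * (δ / 2) ^ 2 * (t + τ - t) = -κ := by rw [hκ]; ring
  linarith

/-- If `q → 0`, `q' = A + w` with `A → 0` and `w' → 0`, then `w → 0`. -/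
lemma tendsto_zero_of_deriv_eq_add {q w A w' : ℝ → E}
    (hq : ∀ t, 0 ≤ t → HasDerivWithinAt q (A t + w t) (Set.Ici 0) t)
    (hw : ∀ t, 0 ≤ t → HasDerivWithinAt w (w' t) (Set.Ici 0) t)
    (hq₀ : Tendsto q atTop (𝓝 0)) (hA₀ : Tendsto A atTop (𝓝 0))
    (hw₀ : Tendsto w' atTop (𝓝 0)) : Tendsto w atTop (𝓝 0) := by
  rw [Metric.tendsto_atTop] at *
  intro δ hδ
  -- Four errors of size δ/5 add up: two values of q, the term A, and the variation of w over a unit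
  -- interval.
  have hδ' : 0 < δ / 5 := by positivity
  obtain ⟨T₁, h₁⟩ := hq₀ _ hδ'
  obtain ⟨T₂, h₂⟩ := hA₀ _ hδ'
  obtain ⟨T₃, h₃⟩ := hw₀ _ hδ'
  simp only [dist_zero_right] at *
  refine ⟨max 0 (max T₁ (max T₂ T₃)), fun t ht => ?_⟩
  simp only [ge_iff_le, max_le_iff] at ht
  obtain ⟨ht₀, ht₁, ht₂, ht₃⟩ := ht
  have hvar : ∀ x ∈ Set.Icc t (t + 1), ‖w x - w t‖ ≤ δ / 5 := fun x hx => by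
    have := norm_sub_le_of_hasDerivWithinAt_Ici hw ht₀ hx.1
      fun y hy => (h₃ y (ht₃.trans hy.1)).le
    nlinarith [hx.2]
  -- Subtracting the line of slope w t leaves a curve whose derivative on [t, t + 1] is at most
  -- 2δ/5.
  have hline : ∀ x, 0 ≤ x → HasDerivWithinAt (fun x => q x - x • w t) (A x + w x - w t)
      (Set.Ici 0) x := fun x hx => by
    refine ((hq x hx).sub ((hasDerivWithinAt_id x (Set.Ici 0)).smul_const (w t))).congr_deriv ?_
    rw [one_smul]
  have hmain := norm_sub_le_of_hasDerivWithinAt_Ici (C := δ / 5 + δ / 5) hline ht₀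
    (by linarith : t ≤ t + 1) fun x hx => by
      rw [add_sub_assoc]
      exact (norm_add_le _ _).trans (add_le_add (h₂ x (ht₂.trans hx.1)).le (hvar x hx))
  have heq : w t = q (t + 1) - q t - (q (t + 1) - (t + 1) • w t - (q t - t • w t)) := by
    rw [add_smul, one_smul]; abel
  have hb₁ := h₁ (t + 1) (by linarith)
  have hb₂ := h₁ t ht₁
  calc ‖w t‖ ≤ ‖q (t + 1) - q t‖ + ‖q (t + 1) - (t + 1) • w t - (q t - t • w t)‖ := by
        conv_lhs => rw [heq]
        exact norm_sub_le _ _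
    _ < δ := by linarith [norm_sub_le (q (t + 1)) (q t)]

/-- Convergence of `q' = A + w`, `w' = -k q` when `A` is, on bounded sets of `q`, strongly
dissipative and linearly bounded. -/
lemma tendsto_zero_of_dissipative_coupling {q w A : ℝ → E} {k : ℝ} (hk : 0 < k)
    (hq : ∀ t, 0 ≤ t → HasDerivWithinAt q (A t + w t) (Set.Ici 0) t)
    (hw : ∀ t, 0 ≤ t → HasDerivWithinAt w (-(k • q t)) (Set.Ici 0) t)
    (hA : ∀ M, ∃ m C, 0 < m ∧ 0 < C ∧ ∀ t, 0 ≤ t → ‖q t‖ ≤ M →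
      inner ℝ (q t) (A t) ≤ -m * ‖q t‖ ^ 2 ∧ ‖A t‖ ≤ C * ‖q t‖) :
    Tendsto w atTop (𝓝 0) ∧ Tendsto q atTop (𝓝 0) := by
  -- The weight k on ‖q‖² is what cancels the cross terms in ⟨q, w⟩.
  have hV : ∀ t, 0 ≤ t → HasDerivWithinAt (fun t => k * ‖q t‖ ^ 2 + ‖w t‖ ^ 2)
      (2 * k * inner ℝ (q t) (A t)) (Set.Ici 0) t := fun t ht => by
    refine (((hq t ht).norm_sq.const_mul k).add (hw t ht).norm_sq).congr_deriv ?_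
    rw [inner_add_right, inner_neg_right, inner_smul_right, real_inner_comm (q t) (w t)]
    ring
  set V₀ := k * ‖q 0‖ ^ 2 + ‖w 0‖ ^ 2 with hV₀
  have hnonpos : ∀ t, 0 ≤ t → inner ℝ (q t) (A t) ≤ 0 := fun t ht => by
    -- Constants depending on t suffice here: only the sign is needed, before any bound on q is
    -- known.
    obtain ⟨m, C, hm, -, h⟩ := hA ‖q t‖
    nlinarith [(h t ht le_rfl).1, sq_nonneg ‖q t‖]
  have hbound : ∀ t, 0 ≤ t → k * ‖q t‖ ^ 2 + ‖w t‖ ^ 2 ≤ V₀ := fun t ht => by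
    have := sub_le_of_hasDerivWithinAt_Ici (C := 0) hV le_rfl ht fun x hx => by
      nlinarith [hnonpos x hx.1]
    linarith
  have hqM : ∀ t, 0 ≤ t → ‖q t‖ ≤ Real.sqrt (V₀ / k) := fun t ht => by
    refine Real.le_sqrt_of_sq_le ?_
    rw [le_div_iff₀ hk]
    nlinarith [hbound t ht, sq_nonneg ‖w t‖]
  have hwM : ∀ t, 0 ≤ t → ‖w t‖ ≤ Real.sqrt V₀ := fun t ht => by
    refine Real.le_sqrt_of_sq_le ?_
    nlinarith [hbound t ht, sq_nonneg ‖q t‖]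
  obtain ⟨m, C, hm, hC, h⟩ := hA (Real.sqrt (V₀ / k))
  have hq₀ : Tendsto q atTop (𝓝 0) := by
    refine tendsto_zero_of_dissipation (m := 2 * k * m)
      -- The added 1 keeps L positive even when V₀ = 0.
      (L := C * Real.sqrt (V₀ / k) + Real.sqrt V₀ + 1) (by positivity) (by positivity) hq
      (fun t ht => ?_) hV (fun t ht => ?_) (fun t _ => by positivity)
    · have h1 := (h t ht (hqM t ht)).2
      have h2 := mul_le_mul_of_nonneg_left (hqM t ht) hC.le
      linarith [norm_add_le (A t) (w t), hwM t ht]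
    · have h1 := mul_le_mul_of_nonneg_left (h t ht (hqM t ht)).1 (by positivity : 0 ≤ 2 * k)
      linarith
  refine ⟨tendsto_zero_of_deriv_eq_add hq hw hq₀ ?_ ?_, hq₀⟩
  · refine squeeze_zero_norm' (a := fun t => C * ‖q t‖) ?_ ?_
    · filter_upwards [eventually_ge_atTop 0] with t ht using (h t ht (hqM t ht)).2
    · simpa using hq₀.norm.const_mul C
  · simpa using (hq₀.const_smul k).neg

end Convergence

end PathFollowing

end

/-! ### The closed loop -/

theorem theorem1 (P : PathFollowing.Params) (hΔ : 0 < P.Δe) (hμ : 0 < P.μ) (hγ : 0 < P.γ)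
    (U : PathFollowing.E3 → ℝ) (hU : PathFollowing.IsSpeedLaw U)
    (I : Set ℝ) (ηp : ℝ → PathFollowing.E3) (hp : PathFollowing.IsRegularPath I ηp)
    (c : PathFollowing.E3) (kc : ℝ) (hkc : 0 < kc)
    (η cHat : ℝ → PathFollowing.E3) (u : ℝ → ℝ)
    (htraj : PathFollowing.IsTrajectory P U I ηp c kc η cHat u) :
    Filter.Tendsto (fun t => ‖c - cHat t‖) Filter.atTop (nhds 0) ∧
      Filter.Tendsto (fun t => ‖PathFollowing.trackErrorAt I ηp η u t‖)
        Filter.atTop (nhds 0) := by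
  have hq : ∀ t, 0 ≤ t → HasDerivWithinAt (fun t => η t - ηp (u t))
      (PathFollowing.rotate (PathFollowing.pathQuat (derivWithin ηp I (u t)))
        (PathFollowing.feedback P U (PathFollowing.trackErrorAt I ηp η u t)) + (c - cHat t))
      (Set.Ici 0) t := fun t ht => by
    have hut := htraj.parameter_mem t ht
    have hηp : HasDerivWithinAt ηp (derivWithin ηp I (u t)) I (u t) :=
      (hp.contDiffOn.differentiableOn one_ne_zero (u t) hut).hasDerivWithinAt
    -- Since u maps [0, ∞) into I, the chain rule holds with one-sided derivatives at endpoints of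
    -- I.
    have hcomp := hηp.scomp t (htraj.parameter t ht) fun s hs => htraj.parameter_mem s hs
    refine ((htraj.kinematics t ht).sub hcomp).congr_deriv ?_
    rw [← PathFollowing.desiredVelocity_sub_parameterRate_smul (hp.regular _ hut)]
    abel
  have hw : ∀ t, 0 ≤ t → HasDerivWithinAt (fun t => c - cHat t) (-(kc • (η t - ηp (u t))))
      (Set.Ici 0) t := fun t ht => (htraj.estimator t ht).const_sub c
  obtain ⟨hw₀, hq₀⟩ := PathFollowing.tendsto_zero_of_dissipative_coupling hkc hq hw fun M => by
    obtain ⟨m, C, hm, hC, h⟩ := PathFollowing.exists_feedback_bounds hΔ hμ hγ hU M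
    refine ⟨m, C, hm, hC, fun t _ ht => ?_⟩
    have hQ := PathFollowing.normSq_pathQuat (derivWithin ηp I (u t))
    -- Both bounds are carried to the path frame, where the feedback is diagonal.
    rw [← PathFollowing.norm_trackError (derivWithin ηp I (u t))] at ht ⊢
    obtain ⟨h1, h2⟩ := h _ ht
    rw [← PathFollowing.rotate_pathQuat_trackError (derivWithin ηp I (u t)) (ηp (u t)) (η t),
      PathFollowing.inner_rotate, hQ, PathFollowing.norm_rotate hQ, one_pow, one_mul]
    exact ⟨h1, h2⟩
  refine ⟨by simpa using hw₀.norm, ?_⟩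
  simpa [PathFollowing.trackErrorAt, PathFollowing.norm_trackError] using hq₀.norm
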